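/- Every irrational $x\in(0,1)$ has a unique Pierce expansion $$x=\sum_{n=0}^\infty\frac{(-1)^n}{\widetilde q_1(x)\cdots\widetilde q_{n+1}(x)},$$ with natural numbers $1\le \widetilde q_1(x)<\widetilde q_2(x)<\cdots$, its digits in the traditional notation. In the Perron notation the expansion is the alternating Perron series $$x=\sum_{n=0}^{\infty}\frac{(-1)^n r_0\cdots r_n}{(q_1-1)q_1\cdots(q_n-1)q_n(q_{n+1}-1)},\qquad r_0=1,\quad r_n=q_n,\quad q_{n+1}\ge r_n+1,$$ with digits $q_n=q_n(x)$, so that $q_n(x)=\widetilde q_n(x)+1$. Let $\mathcal G\colon(0,1)\setminus\mathbb Q\to(0,1)\setminus\mathbb Q$ be the function that increases every digit by one: $q_n(\mathcal G(x))=q_n(x)+1$ for all $n\in\mathbb N$. Let $\psi\colon\mathbb N\to\mathbb R$ be a positive function with $\sum_{n=1}^\infty\frac1{\psi(n)}<\infty$, and put $$\mathfrak B_\psi=\{x\in(0,1)\setminus\mathbb Q:\ q_n(x)\ge\psi(n)\text{ for all sufficiently large }n\}.$$ For a set $\mathfrak M$ of sequences of natural numbers put $$D=\{x\in(0,1)\setminus\mathbb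 Q:(q_n(x))_{n\ge1}\in\mathfrak M\},\qquad \widetilde D=\{x\in(0,1)\setminus\mathbb Q:(\widetilde q_n(x))_{n\ge1}\in\mathfrak M\}.$$ Let $\dim_H$ denote the Hausdorff dimension. Then: 1. For every set $E\subset\mathfrak B_\psi$, $\dim_H\mathcal G(E)=\dim_H E$. 2. For every $\mathfrak M$ such that $D\subseteq\mathfrak B_\psi$ and $\widetilde q_1(x)\ge2$ for all $x\in\widetilde D$, $\dim_H\widetilde D=\dim_H D$. 3. In particular, if every sequence $(a_n)_{n\ge1}\in\mathfrak M$ satisfies $a_1\ge2$ and $a_n\ge\psi(n)$ for all sufficiently large $n$, then $\dim_H D=\dim_H\widetilde D$. -/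

import Mathlib

/-!
Digit sequences `(q_1, q_2, ...)` and functions `ψ(1), ψ(2), ...` are indexed from `0` in the code:
the entry with index `n` is the one with index `n + 1` in the usual notation.
-/

/-- The number `r_n = φ_n(q_1, ..., q_n)` determined by a digit sequence `q` and a sequence of
functions `φ = (φ_n)`, where `φ_n` has `n` arguments (so `φ_0` is a constant). -/
def perronR (φ : (n : ℕ) → (Fin n → ℕ) → ℕ) (q : ℕ → ℕ) (n : ℕ) : ℕ :=
  φ n (fun i => q i)

/-- The `n`-th term of the alternating Perron series,
`(-1)^n r_0 ⋯ r_n / ((q_1 - 1) q_1 ⋯ (q_n - 1) q_n (q_{n+1} - 1))`. -/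
noncomputable def altPerronTerm (φ : (n : ℕ) → (Fin n → ℕ) → ℕ) (q : ℕ → ℕ) (n : ℕ) : ℝ :=
  (-1) ^ n * (∏ i ∈ Finset.range (n + 1), (perronR φ q i : ℝ)) /
    ((∏ i ∈ Finset.range n, ((q i : ℝ) - 1) * (q i : ℝ)) * ((q n : ℝ) - 1))

/-- `q` is the digit sequence of an alternating Perron expansion of `x` determined by `φ`: the `r_n`
are positive integers, `q_{n+1} ≥ r_n + 1` for all `n ≥ 0`, and the series sums to `x`. -/
def IsAltPerronExpansion (φ : (n : ℕ) → (Fin n → ℕ) → ℕ) (q : ℕ → ℕ) (x : ℝ) : Prop :=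
  (∀ n, 1 ≤ perronR φ q n) ∧ (∀ n, perronR φ q n + 1 ≤ q n) ∧ HasSum (altPerronTerm φ q) x

/-- The functions that give the Pierce expansion: `φ_0 = 1` and `φ_n(x_1, ..., x_n) = x_n`. -/
def piercePhi : (n : ℕ) → (Fin n → ℕ) → ℕ
  | 0, _ => 1
  | n + 1, x => x (Fin.last n)

/-- The irrational numbers of the interval `(0, 1)`. -/
def unitIrrationals : Set ℝ :=
  {x | x ∈ Set.Ioo (0 : ℝ) 1 ∧ Irrational x}

/-- The digit sequence `(q_n(x))` of the Pierce expansion of `x` in the Perron notation (every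
irrational `x` in `(0, 1)` has exactly one). -/
noncomputable def pierceDigit (x : ℝ) : ℕ → ℕ :=
  Classical.epsilon (fun q : ℕ → ℕ => IsAltPerronExpansion piercePhi q x)

/-- The number whose Pierce expansion in the Perron notation has the digit sequence `c`. -/
noncomputable def pierceValue (c : ℕ → ℕ) : ℝ :=
  ∑' n, altPerronTerm piercePhi c n

/-- `a` is the digit sequence of the Pierce expansion of `x` in the traditional notation:
`1 ≤ a_1 < a_2 < ⋯` and `x = 1/a_1 - 1/(a_1 a_2) + 1/(a_1 a_2 a_3) - ⋯`. -/
def IsTraditionalPierceExpansion (a : ℕ → ℕ) (x : ℝ) : Prop :=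
  1 ≤ a 0 ∧ StrictMono a ∧
    HasSum (fun n : ℕ => (-1 : ℝ) ^ n / ∏ i ∈ Finset.range (n + 1), (a i : ℝ)) x

/-- The digit sequence of the Pierce expansion of `x` in the traditional notation (every irrational
`x` in `(0, 1)` has exactly one). -/
noncomputable def traditionalPierceDigit (x : ℝ) : ℕ → ℕ :=
  Classical.epsilon (fun a : ℕ → ℕ => IsTraditionalPierceExpansion a x)

/-- The transformation of `(0, 1) \ ℚ` that increases every Pierce digit by one. -/
noncomputable def pierceShift (x : ℝ) : ℝ :=
  pierceValue (fun n => pierceDigit x n + 1)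

/-- The set of `x ∈ (0, 1) \ ℚ` with `q_n(x) ≥ ψ(n)` for all sufficiently large `n`. -/
def pierceGrowthSet (ψ : ℕ → ℝ) : Set ℝ :=
  {x | x ∈ unitIrrationals ∧ ∀ᶠ n in Filter.atTop, ψ n ≤ (pierceDigit x n : ℝ)}

/-- The set of `x ∈ (0, 1) \ ℚ` whose digits in the Perron notation form a sequence in `M`. -/
def perronDigitSet (M : Set (ℕ → ℕ)) : Set ℝ :=
  {x | x ∈ unitIrrationals ∧ pierceDigit x ∈ M}

/-- The set of `x ∈ (0, 1) \ ℚ` whose digits in the traditional notation form a sequence in `M`. -/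
def traditionalDigitSet (M : Set (ℕ → ℕ)) : Set ℝ :=
  {x | x ∈ unitIrrationals ∧ traditionalPierceDigit x ∈ M}

/-! In traditional digits the shift sends the Pierce sum of `a` to that of `succSeq a`. It never
increases distances. If two points first differ at digit `n`, its inverse expands their distance by
at most `12 * ∏ i < n, (1 + 1 / a i)` (`abs_sub_comparison_of_prefix`): each common digit divides
the distance by `a i` before the shift and by `a i + 1` after it, and the first differing digit
costs a constant. On the growth set `∑ 1 / a i` converges, so these products are bounded at each
point. Hence `E` is a countable union of pieces, indexed by `K`, on which the shift is bi-Lipschitz,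
and countable stability of `dimH` gives part 1. Parts 2 and 3 follow because the traditional digits
of the image are the Perron digits of the point, so the shift carries one digit set onto the other.
-/

/-- A sequence of natural numbers `1 ≤ a 0 < a 1 < ⋯`. -/
def IsPierceSeq (a : ℕ → ℕ) : Prop := 1 ≤ a 0 ∧ StrictMono a

/-- The sum of the Pierce series `1/a 0 - 1/(a 0 * a 1) + ⋯`. -/
noncomputable def pierceSum (a : ℕ → ℕ) : ℝ :=
  ∑' n : ℕ, (-1 : ℝ) ^ n / ∏ i ∈ Finset.range (n + 1), (a i : ℝ)

/-- The left shift of a sequence. -/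
def tailSeq (a : ℕ → ℕ) : ℕ → ℕ := fun n => a (n + 1)

/-- The sequence with every entry increased by one. -/
def succSeq (a : ℕ → ℕ) : ℕ → ℕ := fun n => a n + 1

theorem succSeq_tailSeq (a : ℕ → ℕ) : succSeq (tailSeq a) = tailSeq (succSeq a) := rfl

/-! ### Pierce series: recursion, bounds, irrationality, uniqueness of digits. -/

namespace IsPierceSeq

variable {a b : ℕ → ℕ}

theorem succ_le (ha : IsPierceSeq a) (n : ℕ) : n + 1 ≤ a n := by
  induction n with
  | zero => exact ha.1
  | succ n ih => exact Nat.succ_le_of_lt (lt_of_le_of_lt ih (ha.2 (Nat.lt_succ_self n)))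

theorem one_le (ha : IsPierceSeq a) (n : ℕ) : 1 ≤ a n := le_trans (by omega) (ha.succ_le n)

theorem cast_pos (ha : IsPierceSeq a) (n : ℕ) : (0 : ℝ) < a n := by
  exact_mod_cast ha.one_le n

theorem prod_pos (ha : IsPierceSeq a) (n : ℕ) : (0 : ℝ) < ∏ i ∈ Finset.range n, (a i : ℝ) :=
  Finset.prod_pos fun i _ => ha.cast_pos i

theorem tail (ha : IsPierceSeq a) : IsPierceSeq (tailSeq a) :=
  ⟨ha.one_le 1, fun _ _ h => ha.2 (Nat.succ_lt_succ h)⟩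

theorem succ (ha : IsPierceSeq a) : IsPierceSeq (succSeq a) :=
  ⟨Nat.le_add_left 1 _, fun _ _ h => Nat.succ_lt_succ (ha.2 h)⟩

theorem factorial_le_prod (ha : IsPierceSeq a) (n : ℕ) :
    (n.factorial : ℝ) ≤ ∏ i ∈ Finset.range n, (a i : ℝ) := by
  rw [← Finset.prod_range_add_one_eq_factorial]
  push_cast
  exact Finset.prod_le_prod (fun i _ => by positivity) fun i _ => by exact_mod_cast ha.succ_le i

theorem summable (ha : IsPierceSeq a) :
    Summable (fun n : ℕ => (-1 : ℝ) ^ n / ∏ i ∈ Finset.range (n + 1), (a i : ℝ)) := by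
  have h : Summable (fun n : ℕ => (1 : ℝ) / (n.factorial : ℝ)) := by
    simpa using Real.summable_pow_div_factorial 1
  refine Summable.of_norm_bounded ((summable_nat_add_iff 1).2 h) fun n => ?_
  rw [norm_div, norm_pow, norm_neg, norm_one, one_pow, Real.norm_of_nonneg (ha.prod_pos _).le]
  exact one_div_le_one_div_of_le (by positivity) (ha.factorial_le_prod (n + 1))

theorem hasSum (ha : IsPierceSeq a) :
    HasSum (fun n : ℕ => (-1 : ℝ) ^ n / ∏ i ∈ Finset.range (n + 1), (a i : ℝ)) (pierceSum a) :=
  ha.summable.hasSum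

theorem pierceSum_eq (ha : IsPierceSeq a) :
    pierceSum a = (1 - pierceSum (tailSeq a)) / a 0 := by
  have h0 := (ha.cast_pos 0).ne'
  unfold pierceSum
  rw [ha.summable.tsum_eq_zero_add, sub_div, ← tsum_div_const, sub_eq_add_neg, ← tsum_neg]
  congr 1
  · simp
  · congr 1
    funext n
    rw [Finset.prod_range_succ' _ (n + 1), pow_succ, div_div]
    simp only [tailSeq]
    ring

theorem antitone_inv_prod (ha : IsPierceSeq a) :
    Antitone (fun n : ℕ => 1 / ∏ i ∈ Finset.range (n + 1), (a i : ℝ)) := by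
  refine antitone_nat_of_succ_le fun n => ?_
  refine one_div_le_one_div_of_le (ha.prod_pos _) ?_
  rw [Finset.prod_range_succ _ (n + 1)]
  exact le_mul_of_one_le_right (ha.prod_pos _).le (by exact_mod_cast ha.one_le (n + 1))

theorem pierceSum_nonneg_and_le (ha : IsPierceSeq a) :
    0 ≤ pierceSum a ∧ pierceSum a ≤ 1 / a 0 := by
  have ht : Filter.Tendsto (fun n => ∑ i ∈ Finset.range n,
      (-1 : ℝ) ^ i * (1 / ∏ j ∈ Finset.range (i + 1), (a j : ℝ))) Filter.atTop
      (nhds (pierceSum a)) := by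
    simpa [div_eq_mul_inv] using ha.hasSum.tendsto_sum_nat
  have h1 := ha.antitone_inv_prod.alternating_series_le_tendsto ht 0
  have h2 := ha.antitone_inv_prod.tendsto_le_alternating_series ht 0
  simp at h1 h2
  exact ⟨h1, by simpa using h2⟩

theorem pierceSum_pos (ha : IsPierceSeq a) : 0 < pierceSum a := by
  rw [ha.pierceSum_eq]
  refine div_pos ?_ (ha.cast_pos 0)
  have h := ha.tail.pierceSum_nonneg_and_le.2
  have h2 : (2 : ℝ) ≤ tailSeq a 0 := by exact_mod_cast ha.succ_le 1
  have : 1 / (tailSeq a 0 : ℝ) ≤ 1 / 2 := one_div_le_one_div_of_le (by norm_num) h2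
  linarith

theorem pierceSum_lt (ha : IsPierceSeq a) : pierceSum a < 1 / a 0 := by
  rw [ha.pierceSum_eq]
  exact div_lt_div_of_pos_right (by linarith [ha.tail.pierceSum_pos]) (ha.cast_pos 0)

theorem pierceSum_tail_lt (ha : IsPierceSeq a) : pierceSum (tailSeq a) < 1 / (a 0 + 1) := by
  refine ha.tail.pierceSum_lt.trans_le (one_div_le_one_div_of_le (by positivity) ?_)
  exact_mod_cast ha.2 (Nat.lt_succ_self 0)

theorem lt_pierceSum (ha : IsPierceSeq a) : 1 / ((a 0 : ℝ) + 1) < pierceSum a := by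
  have h0 := ha.cast_pos 0
  rw [ha.pierceSum_eq, lt_div_iff₀ h0]
  have h := ha.pierceSum_tail_lt
  have : 1 / ((a 0 : ℝ) + 1) * a 0 = 1 - 1 / ((a 0 : ℝ) + 1) := by field_simp; ring
  linarith

theorem pierceSum_mem_Ioo (ha : IsPierceSeq a) : pierceSum a ∈ Set.Ioo (0 : ℝ) 1 := by
  refine ⟨ha.pierceSum_pos, ha.pierceSum_lt.trans_le ?_⟩
  rw [div_le_one (ha.cast_pos 0)]
  exact_mod_cast ha.1

theorem floor_one_div_pierceSum (ha : IsPierceSeq a) : ⌊1 / pierceSum a⌋₊ = a 0 := by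
  have hp := ha.pierceSum_pos
  rw [Nat.floor_eq_iff (by positivity)]
  constructor
  · rw [le_one_div (ha.cast_pos 0) hp]
    exact ha.pierceSum_lt.le
  · rw [one_div_lt hp (by positivity)]
    exact ha.lt_pierceSum

theorem pierceSum_tail_eq (ha : IsPierceSeq a) :
    pierceSum (tailSeq a) = 1 - a 0 * pierceSum a := by
  rw [ha.pierceSum_eq]
  field_simp [(ha.cast_pos 0).ne']
  ring

/-- Infinite descent: if the sum were `p / q`, the tail would have sum `(q - a 0 * p) / q`, positive
with the same denominator and a smaller numerator. -/
theorem ne_natCast_div (p : ℕ) : ∀ {a : ℕ → ℕ}, IsPierceSeq a → ∀ q : ℕ, 0 < q →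
    pierceSum a ≠ p / q := by
  induction p using Nat.strong_induction_on with
  | _ p ih =>
    intro a ha q hq h
    have hq' : (0 : ℝ) < q := by exact_mod_cast hq
    have htail : pierceSum (tailSeq a) * q = q - a 0 * p := by
      rw [ha.pierceSum_tail_eq, h]
      field_simp
    have hpos : (0 : ℝ) < q - a 0 * p := htail ▸ mul_pos ha.tail.pierceSum_pos hq'
    have hle : a 0 * p ≤ q := by
      have : ((a 0 * p : ℕ) : ℝ) ≤ q := by push_cast; linarith
      exact_mod_cast this
    have hcast : ((q - a 0 * p : ℕ) : ℝ) = q - a 0 * p := by push_cast [Nat.cast_sub hle]; ring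
    have hlt : q - a 0 * p < p := by
      have h1 : pierceSum (tailSeq a) < pierceSum a := ha.pierceSum_tail_lt.trans ha.lt_pierceSum
      have h2 := mul_lt_mul_of_pos_right h1 hq'
      rw [htail, h, div_mul_cancel₀ _ hq'.ne', ← hcast] at h2
      exact_mod_cast h2
    refine ih _ hlt ha.tail q hq ?_
    rw [hcast, eq_div_iff hq'.ne', htail]

theorem irrational (ha : IsPierceSeq a) : Irrational (pierceSum a) := by
  rintro ⟨r, hr⟩
  have hr0 : 0 ≤ r := by
    have := ha.pierceSum_pos.le
    rw [← hr] at this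
    exact_mod_cast this
  refine ne_natCast_div r.num.toNat ha r.den r.den_pos ?_
  rw [← hr]
  conv_lhs => rw [← Rat.num_div_den r]
  push_cast
  congr 1
  have : ((r.num.toNat : ℤ) : ℝ) = (r.num : ℝ) := by
    rw [Int.toNat_of_nonneg (Rat.num_nonneg.2 hr0)]
  exact_mod_cast this.symm

theorem mem_unitIrrationals (ha : IsPierceSeq a) : pierceSum a ∈ unitIrrationals :=
  ⟨ha.pierceSum_mem_Ioo, ha.irrational⟩

theorem apply_eq_of_pierceSum_eq (n : ℕ) : ∀ {a b : ℕ → ℕ}, IsPierceSeq a → IsPierceSeq b →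
    pierceSum a = pierceSum b → a n = b n := by
  induction n with
  | zero =>
    intro a b ha hb h
    rw [← ha.floor_one_div_pierceSum, ← hb.floor_one_div_pierceSum, h]
  | succ n ih =>
    intro a b ha hb h
    refine ih ha.tail hb.tail ?_
    have h0 : a 0 = b 0 := by
      rw [← ha.floor_one_div_pierceSum, ← hb.floor_one_div_pierceSum, h]
    rw [ha.pierceSum_tail_eq, hb.pierceSum_tail_eq, h, h0]

theorem eq_of_pierceSum_eq (ha : IsPierceSeq a) (hb : IsPierceSeq b)
    (h : pierceSum a = pierceSum b) : a = b :=
  funext fun n => apply_eq_of_pierceSum_eq n ha hb h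

end IsPierceSeq

/-! ### Existence of the expansion through the Pierce map. -/

/-- The Pierce map `x ↦ 1 - ⌊1/x⌋ x`. -/
noncomputable def pierceMap (x : ℝ) : ℝ := 1 - ⌊1 / x⌋₊ * x

theorem floor_mul_lt_one {x : ℝ} (hx : x ∈ unitIrrationals) : ⌊1 / x⌋₊ * x < 1 := by
  have hx0 := hx.1.1
  have h : (⌊1 / x⌋₊ : ℝ) ≤ 1 / x := Nat.floor_le (by positivity)
  have h' : (⌊1 / x⌋₊ : ℝ) ≠ 1 / x := by
    have : Irrational (1 / x) := by simpa using hx.2.inv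
    exact (this.ne_nat _).symm
  rw [← lt_div_iff₀ hx0]
  exact lt_of_le_of_ne h h'

theorem one_le_floor {x : ℝ} (hx : x ∈ unitIrrationals) : 1 ≤ ⌊1 / x⌋₊ := by
  refine Nat.le_floor ?_
  rw [Nat.cast_one, le_one_div one_pos hx.1.1]
  simpa using hx.1.2.le

theorem pierceMap_lt {x : ℝ} (hx : x ∈ unitIrrationals) :
    pierceMap x < 1 / ((⌊1 / x⌋₊ : ℝ) + 1) := by
  have hx0 := hx.1.1
  have h := Nat.lt_floor_add_one (1 / x)
  have h1 : 1 < (⌊1 / x⌋₊ + 1 : ℝ) * x := by rwa [div_lt_iff₀ hx0] at h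
  rw [pierceMap, lt_div_iff₀ (by positivity)]
  have : (0 : ℝ) < ⌊1 / x⌋₊ := by exact_mod_cast one_le_floor hx
  nlinarith

theorem pierceMap_mem {x : ℝ} (hx : x ∈ unitIrrationals) : pierceMap x ∈ unitIrrationals := by
  refine ⟨⟨by have := floor_mul_lt_one hx; unfold pierceMap; linarith, ?_⟩, ?_⟩
  · have : (0 : ℝ) < ⌊1 / x⌋₊ := by exact_mod_cast one_le_floor hx
    unfold pierceMap
    nlinarith [hx.1.1]
  · have h1 := hx.2.natCast_mul (m := ⌊1 / x⌋₊) (by have := one_le_floor hx; omega)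
    simpa [pierceMap] using h1.natCast_sub 1

/-- The digits `⌊1/Tⁿx⌋` of `x`, where `T` is the Pierce map. -/
noncomputable def pierceFloorDigit (x : ℝ) (n : ℕ) : ℕ := ⌊1 / (pierceMap^[n] x)⌋₊

theorem iterate_pierceMap_mem {x : ℝ} (hx : x ∈ unitIrrationals) (n : ℕ) :
    pierceMap^[n] x ∈ unitIrrationals := by
  induction n with
  | zero => exact hx
  | succ n ih => rw [Function.iterate_succ_apply']; exact pierceMap_mem ih

theorem isPierceSeq_pierceFloorDigit {x : ℝ} (hx : x ∈ unitIrrationals) :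
    IsPierceSeq (pierceFloorDigit x) := by
  refine ⟨one_le_floor hx, strictMono_nat_of_lt_succ fun n => ?_⟩
  have hn := iterate_pierceMap_mem hx n
  refine Nat.lt_of_succ_le (Nat.le_floor ?_)
  rw [Function.iterate_succ_apply', le_one_div (by positivity) (pierceMap_mem hn).1.1]
  simpa [pierceFloorDigit] using (pierceMap_lt hn).le

theorem pierceSum_pierceFloorDigit {x : ℝ} (hx : x ∈ unitIrrationals) :
    pierceSum (pierceFloorDigit x) = x := by
  have ha := isPierceSeq_pierceFloorDigit hx
  set a := pierceFloorDigit x with hadef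
  -- The exact remainder after `n` digits; it is at most `1 / n!` in absolute value.
  have hpartial : ∀ n, ∑ i ∈ Finset.range n, (-1 : ℝ) ^ i / ∏ j ∈ Finset.range (i + 1), (a j : ℝ)
      = x - (-1) ^ n * (pierceMap^[n] x / ∏ j ∈ Finset.range n, (a j : ℝ)) := by
    intro n
    induction n with
    | zero => simp
    | succ n ih =>
      rw [Finset.sum_range_succ, ih, Function.iterate_succ_apply', Finset.prod_range_succ]
      have h1 := (ha.prod_pos n).ne'
      have h2 := (ha.cast_pos n).ne'
      have h3 : pierceMap (pierceMap^[n] x) = 1 - a n * pierceMap^[n] x := rfl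
      rw [h3]
      field_simp
      ring
  have hlim : Filter.Tendsto
      (fun n => (-1 : ℝ) ^ n * (pierceMap^[n] x / ∏ j ∈ Finset.range n, (a j : ℝ)))
      Filter.atTop (nhds 0) := by
    have hf : Filter.Tendsto (fun n : ℕ => (1 : ℝ) / (n.factorial : ℝ)) Filter.atTop (nhds 0) := by
      simpa using FloorSemiring.tendsto_pow_div_factorial_atTop (1 : ℝ)
    refine squeeze_zero_norm (fun n => ?_) hf
    have hn := (iterate_pierceMap_mem hx n).1
    rw [norm_mul, norm_pow, norm_neg, norm_one, one_pow, one_mul,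
      Real.norm_of_nonneg (div_nonneg hn.1.le (ha.prod_pos n).le)]
    exact div_le_div₀ zero_le_one hn.2.le (by positivity) (ha.factorial_le_prod n)
  have h1 := ha.hasSum.tendsto_sum_nat
  simp_rw [hpartial] at h1
  have h2 := (tendsto_const_nhds (x := x)).sub hlim
  rw [sub_zero] at h2
  exact tendsto_nhds_unique h1 h2

/-! ### Traditional and Perron notation; the shift in terms of digits. -/

theorem isTraditionalPierceExpansion_iff {a : ℕ → ℕ} {x : ℝ} :
    IsTraditionalPierceExpansion a x ↔ IsPierceSeq a ∧ pierceSum a = x := by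
  constructor
  · rintro ⟨h0, h1, h2⟩
    exact ⟨⟨h0, h1⟩, h2.tsum_eq⟩
  · rintro ⟨h, rfl⟩
    exact ⟨h.1, h.2, h.hasSum⟩

theorem altPerronTerm_piercePhi_succSeq {a : ℕ → ℕ} :
    altPerronTerm piercePhi (succSeq a) =
      fun n => (-1 : ℝ) ^ n / ∏ i ∈ Finset.range (n + 1), (a i : ℝ) := by
  funext n
  have h : (∏ i ∈ Finset.range n, ((a i : ℝ) + 1)) ≠ 0 :=
    Finset.prod_ne_zero_iff.2 fun i _ => by positivity
  unfold altPerronTerm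
  -- Splitting off `r_0 = 1` leaves the product of the `r_i = q_i`, which cancels against the
  -- denominator.
  rw [Finset.prod_range_succ', Finset.prod_mul_distrib, Finset.prod_range_succ]
  simp only [perronR, piercePhi, succSeq, Fin.val_last, Nat.cast_add, Nat.cast_one, mul_one,
    add_sub_cancel_right]
  rw [mul_right_comm, mul_div_mul_right _ _ h]

theorem isAltPerronExpansion_succSeq_iff {a : ℕ → ℕ} {x : ℝ} :
    IsAltPerronExpansion piercePhi (succSeq a) x ↔ IsTraditionalPierceExpansion a x := by
  unfold IsAltPerronExpansion IsTraditionalPierceExpansion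
  rw [altPerronTerm_piercePhi_succSeq]
  constructor
  · rintro ⟨-, h2, h3⟩
    refine ⟨?_, strictMono_nat_of_lt_succ fun n => ?_, h3⟩
    · have := h2 0
      simp only [perronR, piercePhi, succSeq] at this
      omega
    · have := h2 (n + 1)
      simp only [perronR, piercePhi, succSeq, Fin.val_last] at this
      omega
  · rintro ⟨h1, h2, h3⟩
    refine ⟨fun n => ?_, fun n => ?_, h3⟩
    · cases n <;> simp [perronR, piercePhi, succSeq]
    · cases n with
      | zero => simpa [perronR, piercePhi, succSeq] using h1
      | succ n =>
        have := h2 (Nat.lt_add_one n)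
        simp only [perronR, piercePhi, succSeq, Fin.val_last]
        omega

theorem IsAltPerronExpansion.exists_succSeq {q : ℕ → ℕ} {x : ℝ}
    (h : IsAltPerronExpansion piercePhi q x) : ∃ a, q = succSeq a := by
  refine ⟨fun n => q n - 1, funext fun n => ?_⟩
  have := h.2.1 n
  simp only [succSeq]
  omega

theorem IsPierceSeq.traditionalPierceDigit {a : ℕ → ℕ} (ha : IsPierceSeq a) :
    traditionalPierceDigit (pierceSum a) = a := by
  have h := Classical.epsilon_spec (p := fun b => IsTraditionalPierceExpansion b (pierceSum a))
    ⟨a, isTraditionalPierceExpansion_iff.2 ⟨ha, rfl⟩⟩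
  rw [isTraditionalPierceExpansion_iff] at h
  exact h.1.eq_of_pierceSum_eq ha h.2

theorem IsPierceSeq.pierceDigit {a : ℕ → ℕ} (ha : IsPierceSeq a) :
    pierceDigit (pierceSum a) = succSeq a := by
  have h := Classical.epsilon_spec (p := fun b => IsAltPerronExpansion piercePhi b (pierceSum a))
    ⟨succSeq a, isAltPerronExpansion_succSeq_iff.2
      (isTraditionalPierceExpansion_iff.2 ⟨ha, rfl⟩)⟩
  obtain ⟨b, hb⟩ := h.exists_succSeq
  rw [hb, isAltPerronExpansion_succSeq_iff, isTraditionalPierceExpansion_iff] at h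
  change Classical.epsilon _ = _
  rw [hb, h.1.eq_of_pierceSum_eq ha h.2]

theorem IsPierceSeq.pierceShift {a : ℕ → ℕ} (ha : IsPierceSeq a) :
    pierceShift (pierceSum a) = pierceSum (succSeq a) := by
  rw [_root_.pierceShift, ha.pierceDigit]
  change pierceValue (succSeq (succSeq a)) = _
  rw [pierceValue, altPerronTerm_piercePhi_succSeq]
  rfl

theorem exists_isPierceSeq {x : ℝ} (hx : x ∈ unitIrrationals) :
    ∃ a, IsPierceSeq a ∧ pierceSum a = x :=
  ⟨_, isPierceSeq_pierceFloorDigit hx, pierceSum_pierceFloorDigit hx⟩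

/-! ### Distances before and after the shift. -/

/-- The distance from `1/m` to a Pierce sum with first digit at least `m` is comparable to the
corresponding distance after all digits and `m` are increased by one. -/
theorem IsPierceSeq.one_div_sub_comparison {a : ℕ → ℕ} (ha : IsPierceSeq a) {m : ℕ} (hm : 1 ≤ m)
    (hma : m ≤ a 0) :
    0 < 1 / ((m : ℝ) + 1) - pierceSum (succSeq a) ∧
    1 / ((m : ℝ) + 1) - pierceSum (succSeq a) ≤ 1 / (m : ℝ) - pierceSum a ∧
    1 / (m : ℝ) - pierceSum a ≤ 6 * (1 / ((m : ℝ) + 1) - pierceSum (succSeq a)) := by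
  have hb : (1 : ℝ) ≤ a 0 := by exact_mod_cast ha.1
  have hc : (1 : ℝ) ≤ tailSeq a 0 := by exact_mod_cast ha.tail.1
  have hm' : (1 : ℝ) ≤ m := by exact_mod_cast hm
  have hma' : (m : ℝ) ≤ a 0 := by exact_mod_cast hma
  have u1 := ha.tail.pierceSum_lt
  have u2 := ha.tail.lt_pierceSum
  have v1 := ha.tail.succ.pierceSum_lt
  have v2 := ha.tail.succ.lt_pierceSum
  have v0 := ha.tail.succ.pierceSum_pos
  have e1 : ((succSeq (tailSeq a) 0 : ℕ) : ℝ) = tailSeq a 0 + 1 := by simp [succSeq]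
  have e2 : ((succSeq a 0 : ℕ) : ℝ) = a 0 + 1 := by simp [succSeq]
  rw [e1] at v1 v2
  rw [ha.pierceSum_eq, ha.succ.pierceSum_eq, e2, ← succSeq_tailSeq]
  generalize pierceSum (tailSeq a) = u at *
  generalize pierceSum (succSeq (tailSeq a)) = v at *
  generalize (tailSeq a 0 : ℝ) = c at *
  generalize (a 0 : ℝ) = b at *
  generalize (m : ℝ) = t at *
  have hvu : v ≤ u := (v1.trans u2).le
  -- Since `u < 1 / c`, `v > 1 / (c + 2)` and `c + 2 ≤ 3 * c`.
  have huv : u ≤ 3 * v := by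
    have : 1 / c ≤ 3 * (1 / (c + 1 + 1)) := by
      rw [mul_one_div, div_le_div_iff₀ (by positivity) (by positivity)]; linarith
    linarith
  -- Both distances split into nonnegative summands that are compared separately; 6 is 3 from `huv`
  -- times 2 from `b + 1 ≤ 2 * b`.
  have L : 1 / t - (1 - u) / b = (b - t) / (t * b) + u / b := by field_simp; ring
  have R : 1 / (t + 1) - (1 - v) / (b + 1) = (b - t) / ((t + 1) * (b + 1)) + v / (b + 1) := by
    field_simp; ring
  have hbt : 0 ≤ b - t := by linarith
  have h1 : (b - t) / ((t + 1) * (b + 1)) ≤ (b - t) / (t * b) := by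
    gcongr <;> linarith
  have h2 : v / (b + 1) ≤ u / b := by
    gcongr
    · exact v0.le.trans hvu
    · linarith
  have h3 : (b - t) / (t * b) ≤ 6 * ((b - t) / ((t + 1) * (b + 1))) := by
    rw [mul_div_assoc', div_le_div_iff₀ (by positivity) (by positivity)]
    have : (t + 1) * (b + 1) ≤ 6 * (t * b) := by nlinarith
    nlinarith
  have h4 : u / b ≤ 6 * (v / (b + 1)) := by
    rw [mul_div_assoc', div_le_div_iff₀ (by positivity) (by positivity)]
    nlinarith
  have h5 : 0 ≤ (b - t) / ((t + 1) * (b + 1)) := by positivity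
  have h6 : 0 < v / (b + 1) := by positivity
  rw [L, R]
  exact ⟨by linarith, by linarith, by linarith⟩

/-- The cylinder endpoint `1 / (a 0 + 1)` separates the two sums, and `1 / (a 0 + 2)` separates
their images, so the distances to the endpoint add up. The constant is 6 times the bound 2 for `(a 0
+ 1) / a 0`. -/
theorem IsPierceSeq.sub_comparison_of_lt {a b : ℕ → ℕ} (ha : IsPierceSeq a) (hb : IsPierceSeq b)
    (h : a 0 < b 0) :
    0 ≤ pierceSum (succSeq a) - pierceSum (succSeq b) ∧
    pierceSum (succSeq a) - pierceSum (succSeq b) ≤ pierceSum a - pierceSum b ∧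
    pierceSum a - pierceSum b ≤ 12 * (pierceSum (succSeq a) - pierceSum (succSeq b)) := by
  obtain ⟨x0, x1, x2⟩ := ha.tail.one_div_sub_comparison (m := a 0 + 1) (by omega)
    (ha.2 (Nat.lt_add_one 0))
  obtain ⟨y0, y1, y2⟩ := hb.one_div_sub_comparison (m := a 0 + 1) (by omega) h
  have hn : (1 : ℝ) ≤ a 0 := by exact_mod_cast ha.1
  have e2 : ((succSeq a 0 : ℕ) : ℝ) = a 0 + 1 := by simp [succSeq]
  rw [ha.pierceSum_eq, ha.succ.pierceSum_eq, e2, ← succSeq_tailSeq]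
  push_cast at x0 x1 x2 y0 y1 y2
  generalize pierceSum (tailSeq a) = u at *
  generalize pierceSum (succSeq (tailSeq a)) = v at *
  generalize pierceSum b = z at *
  generalize pierceSum (succSeq b) = w at *
  generalize (a 0 : ℝ) = n at *
  have L : (1 - u) / n - z = (1 / (n + 1) - u) / n + (1 / (n + 1) - z) := by field_simp; ring
  have R : (1 - v) / (n + 1) - w =
      (1 / (n + 1 + 1) - v) / (n + 1) + (1 / (n + 1 + 1) - w) := by field_simp; ring
  have h1 : (1 / (n + 1 + 1) - v) / (n + 1) ≤ (1 / (n + 1) - u) / n := by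
    gcongr
    · linarith
    · linarith
  have h2 : (1 / (n + 1) - u) / n ≤ 12 * ((1 / (n + 1 + 1) - v) / (n + 1)) := by
    rw [mul_div_assoc', div_le_div_iff₀ (by positivity) (by positivity)]
    nlinarith
  have h3 : 0 < (1 / (n + 1 + 1) - v) / (n + 1) := by positivity
  rw [L, R]
  exact ⟨by linarith, by linarith, by linarith⟩

theorem IsPierceSeq.abs_sub_comparison_of_ne {a b : ℕ → ℕ} (ha : IsPierceSeq a)
    (hb : IsPierceSeq b) (h : a 0 ≠ b 0) :
    |pierceSum (succSeq a) - pierceSum (succSeq b)| ≤ |pierceSum a - pierceSum b| ∧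
    |pierceSum a - pierceSum b| ≤ 12 * |pierceSum (succSeq a) - pierceSum (succSeq b)| := by
  wlog hlt : a 0 < b 0 generalizing a b
  · rw [abs_sub_comm, abs_sub_comm (pierceSum a)]
    exact this hb ha h.symm (lt_of_le_of_ne (not_lt.1 hlt) h.symm)
  obtain ⟨h0, h1, h2⟩ := ha.sub_comparison_of_lt hb hlt
  rw [abs_of_nonneg h0, abs_of_nonneg (h0.trans h1)]
  exact ⟨h1, h2⟩

theorem abs_pierceSum_sub_of_eq {a b : ℕ → ℕ} (ha : IsPierceSeq a) (hb : IsPierceSeq b)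
    (h : a 0 = b 0) :
    |pierceSum a - pierceSum b| = |pierceSum (tailSeq a) - pierceSum (tailSeq b)| / a 0 := by
  rw [ha.pierceSum_eq, hb.pierceSum_eq, ← h, ← sub_div, abs_div, abs_of_pos (ha.cast_pos 0),
    sub_sub_sub_cancel_left, abs_sub_comm]

theorem abs_sub_comparison_of_prefix (n : ℕ) : ∀ {a b : ℕ → ℕ}, IsPierceSeq a → IsPierceSeq b →
    (∀ i < n, a i = b i) → a n ≠ b n →
    |pierceSum (succSeq a) - pierceSum (succSeq b)| ≤ |pierceSum a - pierceSum b| ∧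
    |pierceSum a - pierceSum b| ≤ 12 * (∏ i ∈ Finset.range n, (1 + 1 / (a i : ℝ))) *
      |pierceSum (succSeq a) - pierceSum (succSeq b)| := by
  induction n with
  | zero =>
    intro a b ha hb _ h
    simpa using ha.abs_sub_comparison_of_ne hb h
  | succ n ih =>
    intro a b ha hb he h
    have h0 := he 0 (Nat.succ_pos n)
    obtain ⟨h1, h2⟩ := ih ha.tail hb.tail (fun i hi => he (i + 1) (Nat.succ_lt_succ hi)) h
    have hpos := ha.cast_pos 0
    rw [abs_pierceSum_sub_of_eq ha hb h0,
      abs_pierceSum_sub_of_eq ha.succ hb.succ (congrArg (· + 1) h0), ← succSeq_tailSeq,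
      ← succSeq_tailSeq, Finset.prod_range_succ']
    have e2 : ((succSeq a 0 : ℕ) : ℝ) = a 0 + 1 := by simp [succSeq]
    rw [e2]
    constructor
    · gcongr
      linarith
    · have h3 := div_le_div_of_nonneg_right h2 hpos.le
      refine h3.trans_eq ?_
      simp only [tailSeq]
      field_simp

theorem IsPierceSeq.abs_sub_comparison {a b : ℕ → ℕ} (ha : IsPierceSeq a) (hb : IsPierceSeq b)
    {K : ℝ} (hK : ∀ n, ∏ i ∈ Finset.range n, (1 + 1 / (a i : ℝ)) ≤ K) :
    |pierceSum (succSeq a) - pierceSum (succSeq b)| ≤ |pierceSum a - pierceSum b| ∧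
    |pierceSum a - pierceSum b| ≤
      12 * K * |pierceSum (succSeq a) - pierceSum (succSeq b)| := by
  classical
  by_cases hab : a = b
  · simp [hab]
  · have hex := Function.ne_iff.1 hab
    obtain ⟨h1, h2⟩ := abs_sub_comparison_of_prefix (Nat.find hex) ha hb
      (fun i hi => not_not.1 (Nat.find_min hex hi)) (Nat.find_spec hex)
    refine ⟨h1, h2.trans ?_⟩
    gcongr
    exact hK _

/-! ### Bi-Lipschitz pieces and Hausdorff dimension. -/

/-- The points of `E` whose digits satisfy `∏ (1 + 1/(q_n - 1)) ≤ K` for all partial products. -/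
def boundedProductPart (E : Set ℝ) (K : ℕ) : Set ℝ :=
  {x | x ∈ E ∧ ∃ a, IsPierceSeq a ∧ pierceSum a = x ∧
    ∀ n, ∏ i ∈ Finset.range n, (1 + 1 / (a i : ℝ)) ≤ K}

theorem dimH_pierceShift_image_boundedProductPart (E : Set ℝ) (K : ℕ) :
    dimH (pierceShift '' boundedProductPart E K) = dimH (boundedProductPart E K) := by
  set S := boundedProductPart E K
  have key : ∀ x ∈ S, ∀ y ∈ S, |pierceShift x - pierceShift y| ≤ |x - y| ∧
      |x - y| ≤ 12 * (K : ℝ) * |pierceShift x - pierceShift y| := by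
    -- One point's bound suffices: the product runs over the common prefix.
    rintro x ⟨-, a, ha, rfl, hK⟩ y ⟨-, b, hb, rfl, -⟩
    rw [ha.pierceShift, hb.pierceShift]
    exact ha.abs_sub_comparison hb hK
  apply le_antisymm
  · refine LipschitzOnWith.dimH_image_le (K := 1) (LipschitzOnWith.of_dist_le_mul ?_)
    intro x hx y hy
    simpa [Real.dist_eq] using (key x hx y hy).1
  · have hanti : AntilipschitzWith (12 * (K : NNReal)) (fun x : S => pierceShift x) := by
      refine AntilipschitzWith.of_le_mul_dist fun x y => ?_
      simpa [Real.dist_eq, Subtype.dist_eq] using (key x x.2 y y.2).2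
    have h := hanti.le_dimH_image Set.univ
    rw [← isometry_subtype_coe.dimH_image (Set.univ : Set S), Set.image_univ,
      Set.image_univ, Subtype.range_coe] at h
    rwa [Set.image_eq_range]

theorem exists_forall_prod_one_add_le {u : ℕ → ℝ} (hu : ∀ n, 0 ≤ u n) (hs : Summable u) :
    ∃ K : ℕ, ∀ n, ∏ i ∈ Finset.range n, (1 + u i) ≤ K := by
  obtain ⟨K, hK⟩ := exists_nat_ge (Real.exp (∑' i, u i))
  refine ⟨K, fun n => le_trans ?_ hK⟩
  calc ∏ i ∈ Finset.range n, (1 + u i) ≤ ∏ i ∈ Finset.range n, Real.exp (u i) :=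
        Finset.prod_le_prod (fun i _ => by linarith [hu i])
          fun i _ => by linarith [Real.add_one_le_exp (u i)]
    _ = Real.exp (∑ i ∈ Finset.range n, u i) := (Real.exp_sum _ _).symm
    _ ≤ _ := Real.exp_le_exp.2 (hs.sum_le_tsum _ fun i _ => hu i)

theorem IsPierceSeq.summable_one_div {a : ℕ → ℕ} (ha : IsPierceSeq a) {ψ : ℕ → ℝ}
    (hψ : ∀ n, 0 < ψ n) (hsum : Summable (fun n => 1 / ψ n))
    (h : ∀ᶠ n in Filter.atTop, ψ n ≤ (succSeq a n : ℝ)) :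
    Summable (fun n => 1 / (a n : ℝ)) := by
  refine Summable.of_norm_bounded_eventually_nat (hsum.mul_left 2) ?_
  filter_upwards [h] with n hn
  have h1 : (1 : ℝ) ≤ a n := by exact_mod_cast ha.one_le n
  have h2 := hψ n
  simp only [succSeq, Nat.cast_add, Nat.cast_one] at hn
  rw [Real.norm_of_nonneg (by positivity), mul_one_div, div_le_div_iff₀ (by positivity) h2]
  -- Here `ψ n ≤ a n + 1 ≤ 2 * a n`, whence the factor 2.
  linarith

theorem iUnion_boundedProductPart {ψ : ℕ → ℝ} (hψ : ∀ n, 0 < ψ n)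
    (hsum : Summable (fun n => 1 / ψ n)) {E : Set ℝ} (hE : E ⊆ pierceGrowthSet ψ) :
    ⋃ K, boundedProductPart E K = E := by
  refine Set.Subset.antisymm (Set.iUnion_subset fun K x hx => hx.1) fun x hx => ?_
  obtain ⟨hx1, hx2⟩ := hE hx
  obtain ⟨a, ha, rfl⟩ := exists_isPierceSeq hx1
  rw [ha.pierceDigit] at hx2
  obtain ⟨K, hK⟩ := exists_forall_prod_one_add_le (fun n => by positivity)
    (ha.summable_one_div hψ hsum hx2)
  exact Set.mem_iUnion.2 ⟨K, hx, a, ha, rfl, hK⟩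

theorem dimH_pierceShift_image {ψ : ℕ → ℝ} (hψ : ∀ n, 0 < ψ n)
    (hsum : Summable (fun n => 1 / ψ n)) {E : Set ℝ} (hE : E ⊆ pierceGrowthSet ψ) :
    dimH (pierceShift '' E) = dimH E := by
  rw [← iUnion_boundedProductPart hψ hsum hE, Set.image_iUnion, dimH_iUnion, dimH_iUnion]
  simp_rw [dimH_pierceShift_image_boundedProductPart]

theorem pierceShift_image_perronDigitSet {M : Set (ℕ → ℕ)}
    (hM : ∀ x ∈ traditionalDigitSet M, 2 ≤ traditionalPierceDigit x 0) :
    pierceShift '' perronDigitSet M = traditionalDigitSet M := by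
  apply Set.Subset.antisymm
  · rintro _ ⟨x, ⟨hx, hxM⟩, rfl⟩
    obtain ⟨a, ha, rfl⟩ := exists_isPierceSeq hx
    rw [ha.pierceDigit] at hxM
    rw [ha.pierceShift]
    exact ⟨ha.succ.mem_unitIrrationals, by rwa [ha.succ.traditionalPierceDigit]⟩
  · intro y hy
    have h2 := hM y hy
    obtain ⟨hy, hyM⟩ := hy
    obtain ⟨b, hb, rfl⟩ := exists_isPierceSeq hy
    rw [hb.traditionalPierceDigit] at hyM h2
    -- The preimage lowers every digit by one; a first digit of at least 2 keeps it a Pierce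
    -- sequence.
    obtain ⟨a, rfl⟩ : ∃ a, b = succSeq a := by
      refine ⟨fun n => b n - 1, funext fun n => ?_⟩
      have := hb.one_le n
      simp only [succSeq]
      omega
    have ha : IsPierceSeq a := by
      refine ⟨?_, fun i j hij => Nat.lt_of_succ_lt_succ (hb.2 hij)⟩
      simp only [succSeq] at h2
      omega
    exact ⟨pierceSum a, ⟨ha.mem_unitIrrationals, by rwa [ha.pierceDigit]⟩, ha.pierceShift⟩

theorem mainTheorem3 (ψ : ℕ → ℝ) (hψ : ∀ n, 0 < ψ n) (hsum : Summable (fun n => 1 / ψ n)) :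
    (∀ E : Set ℝ, E ⊆ pierceGrowthSet ψ → dimH (pierceShift '' E) = dimH E) ∧
    (∀ M : Set (ℕ → ℕ), perronDigitSet M ⊆ pierceGrowthSet ψ →
      (∀ x ∈ traditionalDigitSet M, 2 ≤ traditionalPierceDigit x 0) →
      dimH (traditionalDigitSet M) = dimH (perronDigitSet M)) ∧
    (∀ M : Set (ℕ → ℕ),
      (∀ a ∈ M, (∀ᶠ n in Filter.atTop, ψ n ≤ (a n : ℝ)) ∧ 2 ≤ a 0) →
      dimH (perronDigitSet M) = dimH (traditionalDigitSet M)) := by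
  have h2 : ∀ M : Set (ℕ → ℕ), perronDigitSet M ⊆ pierceGrowthSet ψ →
      (∀ x ∈ traditionalDigitSet M, 2 ≤ traditionalPierceDigit x 0) →
      dimH (traditionalDigitSet M) = dimH (perronDigitSet M) := fun M hD hM => by
    rw [← pierceShift_image_perronDigitSet hM, dimH_pierceShift_image hψ hsum hD]
  refine ⟨fun E hE => dimH_pierceShift_image hψ hsum hE, h2, fun M hM => (h2 M ?_ ?_).symm⟩
  · exact fun x hx => ⟨hx.1, (hM _ hx.2).1⟩
  · exact fun x hx => (hM _ hx.2).2
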